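/- Let $M$ be a compact $2$-point-homogeneous space: a compact metric space $(M,\rho)$ on which a group $G$ acts by isometries such that whenever $\rho(x,y)=\rho(x',y')$ there is $g\in G$ with $gx=x'$ and $gy=y'$. Let $\mu$ be the $G$-invariant Borel probability measure on $M$, let $\tau(x,y)=F(\rho(x,y))$ for a function $F:\mathbb R\to\mathbb R$, and put $\tau_0=\tau(x,x)=F(0)$. Let $$L^2(M,\mu)=\widehat{\bigoplus_{0\le k<N}}\;V_k,\qquad N\in\mathbb N\cup\{\infty\},$$ be a decomposition into pairwise orthogonal irreducible $G$-invariant spaces of continuous complex-valued functions, each finite-dimensional, where $V_0$ is the space of constants. Let $\Phi_k:\mathbb R\to\mathbb R$ ($0\le k<N$) be the corresponding zonal spherical functions in the variable $\tau$; that is, for every $y\in M$ the function $x\mapsto\Phi_k(\tau(x,y))$ belongs to $V_k$, and $\Phi_k(\tau_0)=1$. (Here $N=\infty$ when $M$ is infinite, whereas a finite $M$ has only finitely many zonal spherical functions.) For finite subsets $X,Y\subset M$ put $$F_k(X,Y)=\sum_{x\in X,\;y\in Y}\Phi_k(\tau(x,y)).$$ Then for all finite subsets $X_1,\dots,X_d$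 of $M$ and every integer $k$ with $0\le k<N$, the real symmetric $d\times d$ matrix $\bigl(F_k(X_i,X_j)\bigr)_{i,j=1}^d$ is positive semidefinite. -/

import Mathlib

open MeasureTheory

/-- A metric space `M` with an action of a group `G` is 2-point-homogeneous if the distance is
strongly invariant under `G`: the elements of `G` act as isometries, and any two pairs of points
at the same distance are equivalent under `G`. -/
class TwoPointHomogeneousSpace (G M : Type*) [Group G] [MetricSpace M] [MulAction G M] : Prop
    extends IsIsometricSMul G M where
  exists_smul_eq : ∀ x y x' y' : M, dist x y = dist x' y' →
    ∃ g : G, g • x = x' ∧ g • y = y'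

/-- A space of continuous functions on `M` is `G`-invariant if it is stable under
all the substitutions `f ↦ (x ↦ f (g • x))`. -/
def IsInvariantSpace (G : Type*) {M : Type*} [Group G] [MetricSpace M] [MulAction G M]
    [TwoPointHomogeneousSpace G M] (V : Submodule ℂ C(M, ℂ)) : Prop :=
  ∀ g : G, ∀ f ∈ V, f.comp ⟨fun x : M => g • x, continuous_const_smul g⟩ ∈ V

/-- A (finite-dimensional) irreducible `G`-invariant space of continuous functions on `M`. For
compact `M` every closed irreducible `G`-invariant subspace of `L²(M)` is finite-dimensional and
consists of (classes of) continuous functions. -/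
structure IsIrreducibleSpace (G : Type*) {M : Type*} [Group G] [MetricSpace M] [MulAction G M]
    [TwoPointHomogeneousSpace G M] (V : Submodule ℂ C(M, ℂ)) : Prop where
  finiteDimensional : FiniteDimensional ℂ V
  invariant : IsInvariantSpace G V
  ne_bot : V ≠ ⊥
  eq_bot_or_eq : ∀ W : Submodule ℂ C(M, ℂ), W ≤ V → IsInvariantSpace G W → W = ⊥ ∨ W = V

/-- `L²(M, μ)` is the orthogonal Hilbert sum of the irreducible `G`-invariant spaces `V k`, where
`k` runs through the natural numbers `k < N` (all of them if `N = ⊤`, as is the case for infinite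
`M`), and `V 0` is the space of constants. -/
structure IsHarmonicDecomposition (G : Type*) {M : Type*} [Group G] [MetricSpace M]
    [MulAction G M] [TwoPointHomogeneousSpace G M] [CompactSpace M] [MeasurableSpace M]
    [BorelSpace M] (μ : Measure M) [IsFiniteMeasure μ]
    (N : ℕ∞) (V : ℕ → Submodule ℂ C(M, ℂ)) : Prop where
  zero : V 0 = Submodule.span ℂ {(1 : C(M, ℂ))}
  irreducible : ∀ k : ℕ, (k : ℕ∞) < N → IsIrreducibleSpace G (V k)
  orthogonal : ∀ j k : ℕ, (j : ℕ∞) < N → (k : ℕ∞) < N → j ≠ k →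
    ∀ f ∈ V j, ∀ h ∈ V k, ∫ x, f x * starRingEnd ℂ (h x) ∂μ = 0
  dense : ((⨆ (k : ℕ) (_ : (k : ℕ∞) < N), V k).map
    (ContinuousMap.toLp (E := ℂ) 2 μ ℂ).toLinearMap).topologicalClosure = ⊤

/-- With `τ(x, y) = F (dist x y)`, the function `φ` is the zonal spherical function of the
irreducible space `V`: for every point `y` the function `x ↦ φ (τ(x, y))`, which depends only on
the distance to the pole `y`, belongs to `V`, and `φ` is normalized by `φ (τ₀) = 1`, where
`τ₀ = τ(x, x) = F 0`. (These conditions determine `φ` on the set of values of `τ`.) -/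
structure IsZonalFunctionOf {M : Type*} [MetricSpace M] (F : ℝ → ℝ)
    (V : Submodule ℂ C(M, ℂ)) (φ : ℝ → ℝ) : Prop where
  mem : ∀ y : M, ∃ f ∈ V, ∀ x : M, f x = (φ (F (dist x y)) : ℂ)
  normalized : φ (F 0) = 1

/-- `Φ k`, `k < N`, are the zonal spherical functions of the compact 2-point-homogeneous space
`M`, in the variable `τ = F ∘ dist`: they belong to the irreducible summands of `L²(M, μ)`. -/
def IsZonalSystem (G : Type*) {M : Type*} [Group G] [MetricSpace M]
    [MulAction G M] [TwoPointHomogeneousSpace G M] [CompactSpace M] [MeasurableSpace M]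
    [BorelSpace M] (μ : Measure M) [IsFiniteMeasure μ]
    (F : ℝ → ℝ) (N : ℕ∞) (Φ : ℕ → ℝ → ℝ) : Prop :=
  ∃ V : ℕ → Submodule ℂ C(M, ℂ), IsHarmonicDecomposition G μ N V ∧
    ∀ k : ℕ, (k : ℕ∞) < N → IsZonalFunctionOf F (V k) (Φ k)

/-- The sum of `φ (τ(x, y))` over `x ∈ X`, `y ∈ Y`, where `τ(x, y) = F (dist x y)`. -/
noncomputable def zonalSum {M : Type*} [MetricSpace M] (F : ℝ → ℝ) (φ : ℝ → ℝ)
    (X Y : Finset M) : ℝ :=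
  ∑ x ∈ X, ∑ y ∈ Y, φ (F (dist x y))

/-!
Let `V` be an irreducible invariant space with zonal functions `Z y : x ↦ φ (τ(x, y))`, `y ∈ M`. The
integral operator on `V` with kernel `Z` commutes with the group, so by Schur's lemma it is a scalar
`c`; applied to `Z w` this says that `⟪Z x, Z w⟫ = c * φ (τ(x, w))` in `L²(M, μ)`. Taking `x = w`
gives `c = ‖Z x‖² > 0`, because an invariant measure charges all nonempty open sets. Hence
`φ (τ(x, w))` is the inner product of the vectors `Z x` and `Z w`, up to normalization, and the
matrix of the sums over `X i × X j` is the Gram matrix of the vectors `∑ x ∈ X i, Z x`.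
-/

section FunctionSpaces

variable {𝕜 X : Type*} [RCLike 𝕜] [TopologicalSpace X] {V : Submodule 𝕜 C(X, 𝕜)}

theorem continuous_of_forall_continuous_eval [FiniteDimensional 𝕜 V] {Y : Type*}
    [TopologicalSpace Y] {z : Y → V} (hz : ∀ x, Continuous fun y => (z y : C(X, 𝕜)) x) :
    Continuous z := by
  let eval : V →ₗ[𝕜] X → 𝕜 := (ContinuousMap.coeFnLinearMap 𝕜).comp V.subtype
  have heval : LinearMap.ker eval = ⊥ :=
    LinearMap.ker_eq_bot_of_injective (DFunLike.coe_injective.comp Subtype.coe_injective)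
  exact (LinearMap.isClosedEmbedding_of_injective heval).continuous_iff.mpr (continuous_pi hz)

variable [CompactSpace X] [MeasurableSpace X] [OpensMeasurableSpace X]
  (μ : Measure X) [IsFiniteMeasure μ]

theorem integrable_smul_of_compactSpace {E : Type*} [NormedAddCommGroup E] [NormedSpace 𝕜 E]
    (f : C(X, 𝕜)) (z : C(X, E)) : Integrable (fun y => f y • z y) μ :=
  (f.continuous.smul z.continuous).integrable_of_hasCompactSupport (.of_compactSpace _)

/-- The integral operator `f ↦ (x ↦ ∫ f y * z y x ∂μ)` on a complete space `V` of continuous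
functions, for a kernel `z` with `z y ∈ V` for all `y`. The integral is taken in `V`, so it has the
junk value `0` if `V` is not complete. -/
noncomputable def kernelOperator (z : C(X, V)) : Module.End 𝕜 V where
  toFun f := ∫ y, (f : C(X, 𝕜)) y • z y ∂μ
  map_add' f h := by
    simp only [Submodule.coe_add, ContinuousMap.add_apply, add_smul]
    exact integral_add (integrable_smul_of_compactSpace μ (f : C(X, 𝕜)) z)
      (integrable_smul_of_compactSpace μ (h : C(X, 𝕜)) z)
  map_smul' a f := by
    simp only [Submodule.coe_smul, ContinuousMap.smul_apply, smul_assoc, RingHom.id_apply]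
    exact integral_smul a _

theorem kernelOperator_apply [CompleteSpace V] (z : C(X, V)) (f : V) (x : X) :
    (kernelOperator μ z f : C(X, 𝕜)) x =
      ∫ y, (f : C(X, 𝕜)) y * (z y : C(X, 𝕜)) x ∂μ :=
  (((ContinuousMap.evalCLM 𝕜 x).comp V.subtypeL).integral_comp_comm
    (integrable_smul_of_compactSpace μ (f : C(X, 𝕜)) z)).symm

end FunctionSpaces

/-- The representation of `G` on `C(X, 𝕜)` by the translations `f ↦ (x ↦ f (g⁻¹ • x))`. -/
noncomputable def translationRepresentation (𝕜 G X : Type*) [RCLike 𝕜] [Group G]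
    [TopologicalSpace X] [MulAction G X] [ContinuousConstSMul G X] :
    Representation 𝕜 G C(X, 𝕜) where
  toFun g := (ContinuousMap.compRightAlgHom 𝕜 𝕜
    ⟨fun x : X => g⁻¹ • x, continuous_const_smul g⁻¹⟩).toLinearMap
  map_one' := by
    ext f x
    simp
  map_mul' g h := by
    ext f x
    simp [mul_smul]

section TwoPointHomogeneous

variable {G M : Type*} [Group G] [MetricSpace M] [MulAction G M] [TwoPointHomogeneousSpace G M]
  {V : Submodule ℂ C(M, ℂ)}

/-- The representation of `G` on a `G`-invariant space of functions. -/
noncomputable def IsInvariantSpace.representation (hV : IsInvariantSpace G V) :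
    Representation ℂ G V :=
  Subrepresentation.toRepresentation (ρ := translationRepresentation ℂ G M)
    ⟨V, fun g f hf => hV g⁻¹ f hf⟩

theorem IsInvariantSpace.representation_apply (hV : IsInvariantSpace G V) (g : G) (f : V) (x : M) :
    (hV.representation g f : C(M, ℂ)) x = (f : C(M, ℂ)) (g⁻¹ • x) := rfl

theorem IsIrreducibleSpace.isIrreducible_representation (hV : IsIrreducibleSpace G V) :
    Representation.IsIrreducible (k := ℂ) (V := V) hV.invariant.representation where
  exists_pair_ne := by
    have : Nontrivial V := Submodule.nontrivial_iff_ne_bot.mpr hV.ne_bot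
    exact ⟨⊥, ⊤, fun h => bot_ne_top (congrArg Subrepresentation.toSubmodule h)⟩
  eq_bot_or_eq_top W := by
    have hinv : IsInvariantSpace G (W.toSubmodule.map V.subtype) := by
      rintro g _ ⟨f, hf, rfl⟩
      refine ⟨_, W.apply_mem_toSubmodule g⁻¹ hf, ?_⟩
      ext x
      simp [hV.invariant.representation_apply]
    have hmap : Function.Injective fun W : Subrepresentation hV.invariant.representation =>
        W.toSubmodule.map V.subtype :=
      (Submodule.map_injective_of_injective V.injective_subtype).comp
        Subrepresentation.toSubmodule_injective
    exact (hV.eq_bot_or_eq _ (Submodule.map_subtype_le V _) hinv).imp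
      (fun h => hmap (h.trans (Submodule.map_bot _).symm))
      (fun h => hmap (h.trans (Submodule.map_subtype_top V).symm))

theorem IsIrreducibleSpace.exists_eq_smul (hV : IsIrreducibleSpace G V)
    (A : hV.invariant.representation.IntertwiningMap hV.invariant.representation) :
    ∃ c : ℂ, ∀ f, A f = c • f := by
  have := hV.finiteDimensional
  have := hV.isIrreducible_representation
  obtain ⟨c, rfl⟩ :=
    (Representation.IsIrreducible.algebraMap_intertwiningMap_bijective_of_isAlgClosed
      (k := ℂ) (V := V) (ρ := hV.invariant.representation)).surjective A
  exact ⟨c, fun _ => rfl⟩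

variable (G M) in
theorem TwoPointHomogeneousSpace.isPretransitive : MulAction.IsPretransitive G M where
  exists_smul_eq x x' :=
    let ⟨g, hg, _⟩ := TwoPointHomogeneousSpace.exists_smul_eq (G := G) x x x' x' (by simp)
    ⟨g, hg⟩

variable [CompactSpace M] [MeasurableSpace M] (μ : Measure M)

variable (G) in
theorem TwoPointHomogeneousSpace.isOpenPosMeasure [SMulInvariantMeasure G M μ] [NeZero μ] :
    μ.IsOpenPosMeasure where
  open_pos _ hU hne :=
    have := TwoPointHomogeneousSpace.isPretransitive G M
    (measure_isOpen_pos_of_smulInvariant_of_compact_ne_zero G isCompact_univ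
      (Measure.measure_univ_ne_zero.mpr (NeZero.ne μ)) hU hne).ne'

variable [BorelSpace M] [IsFiniteMeasure μ]

theorem kernelOperator_representation [SMulInvariantMeasure G M μ] [CompleteSpace V]
    (hV : IsInvariantSpace G V) {z : C(M, V)}
    (hz : ∀ (g : G) x y, (z (g • y) : C(M, ℂ)) (g • x) = (z y : C(M, ℂ)) x) (g : G) (f : V) :
    kernelOperator μ z (hV.representation g f) = hV.representation g (kernelOperator μ z f) := by
  ext x
  calc (kernelOperator μ z (hV.representation g f) : C(M, ℂ)) x
      = ∫ y, (f : C(M, ℂ)) (g⁻¹ • y) * (z (g⁻¹ • y) : C(M, ℂ)) (g⁻¹ • x) ∂μ := by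
        simp only [kernelOperator_apply, hV.representation_apply, hz]
    _ = ∫ y, (f : C(M, ℂ)) y * (z y : C(M, ℂ)) (g⁻¹ • x) ∂μ :=
        integral_smul_eq_self (fun y => (f : C(M, ℂ)) y * (z y : C(M, ℂ)) (g⁻¹ • x))
    _ = (hV.representation g (kernelOperator μ z f) : C(M, ℂ)) x := by
        rw [hV.representation_apply, kernelOperator_apply]

theorem IsIrreducibleSpace.exists_kernelOperator_eq_smul [SMulInvariantMeasure G M μ]
    (hV : IsIrreducibleSpace G V) {z : C(M, V)}
    (hz : ∀ (g : G) x y, (z (g • y) : C(M, ℂ)) (g • x) = (z y : C(M, ℂ)) x) :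
    ∃ c : ℂ, ∀ f, kernelOperator μ z f = c • f :=
  have := hV.finiteDimensional
  have : CompleteSpace V := FiniteDimensional.complete ℂ V
  hV.exists_eq_smul <| (kernelOperator μ z).intertwiningMap_of_isIntertwiningMap
    _ _ (kernelOperator_representation μ hV.invariant hz)

end TwoPointHomogeneous

namespace IsZonalFunctionOf

variable {M : Type*} [MetricSpace M] {V : Submodule ℂ C(M, ℂ)} {F φ : ℝ → ℝ}

/-- The zonal function `x ↦ φ (τ(x, y))` with pole `y`, as an element of `V`. -/
noncomputable def zonal (hφ : IsZonalFunctionOf F V φ) (y : M) : V :=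
  ⟨(hφ.mem y).choose, (hφ.mem y).choose_spec.1⟩

theorem zonal_apply (hφ : IsZonalFunctionOf F V φ) (y x : M) :
    (hφ.zonal y : C(M, ℂ)) x = φ (F (dist x y)) :=
  (hφ.mem y).choose_spec.2 x

theorem continuous_zonal [FiniteDimensional ℂ V] (hφ : IsZonalFunctionOf F V φ) :
    Continuous hφ.zonal := by
  refine continuous_of_forall_continuous_eval fun x => ?_
  have hsymm : (fun y => (hφ.zonal y : C(M, ℂ)) x) = (hφ.zonal x : C(M, ℂ)) := by
    ext y
    simp only [zonal_apply, dist_comm x]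
  exact hsymm ▸ ContinuousMap.continuous _

/-- The zonal function `x ↦ φ (τ(x, y))` with pole `y`, as a real-valued function. -/
noncomputable def realZonal (hφ : IsZonalFunctionOf F V φ) (y : M) : C(M, ℝ) :=
  ⟨fun x => φ (F (dist x y)), by
    have hre : Continuous fun x => ((hφ.zonal y : C(M, ℂ)) x).re := by fun_prop
    simpa only [zonal_apply, Complex.ofReal_re] using hre⟩

theorem realZonal_self (hφ : IsZonalFunctionOf F V φ) (y : M) : hφ.realZonal y y = 1 := by
  simpa only [realZonal, ContinuousMap.coe_mk, dist_self] using hφ.normalized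

variable [CompactSpace M] [MeasurableSpace M] [BorelSpace M] (μ : Measure M) [IsFiniteMeasure μ]

/-- The zonal function with pole `y`, as a vector of the real Hilbert space `L²(M, μ)`. -/
noncomputable def zonalLp (hφ : IsZonalFunctionOf F V φ) (y : M) : Lp ℝ 2 μ :=
  ContinuousMap.toLp 2 μ ℝ (hφ.realZonal y)

theorem inner_zonalLp (hφ : IsZonalFunctionOf F V φ) (x w : M) :
    inner ℝ (hφ.zonalLp μ x) (hφ.zonalLp μ w) =
      ∫ y, φ (F (dist y w)) * φ (F (dist x y)) ∂μ := by
  simp only [zonalLp, ContinuousMap.inner_toLp, realZonal, ContinuousMap.coe_mk, conj_trivial,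
    dist_comm x]

variable {G : Type*} [Group G] [MulAction G M] [TwoPointHomogeneousSpace G M]

variable (G) in
theorem zonalLp_ne_zero [SMulInvariantMeasure G M μ] [NeZero μ]
    (hφ : IsZonalFunctionOf F V φ) (y : M) : hφ.zonalLp μ y ≠ 0 := by
  have := TwoPointHomogeneousSpace.isOpenPosMeasure G μ
  intro h
  have hzero : hφ.realZonal y = 0 := ContinuousMap.toLp_injective μ (h.trans (map_zero _).symm)
  simpa [hzero] using hφ.realZonal_self y

variable [SMulInvariantMeasure G M μ]

theorem exists_inner_zonalLp_eq_mul (hφ : IsZonalFunctionOf F V φ)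
    (hV : IsIrreducibleSpace G V) :
    ∃ c : ℂ, ∀ x w : M,
      ((inner ℝ (hφ.zonalLp μ x) (hφ.zonalLp μ w) : ℝ) : ℂ) = c * φ (F (dist x w)) := by
  have := hV.finiteDimensional
  obtain ⟨c, hc⟩ := hV.exists_kernelOperator_eq_smul μ
    (z := ⟨hφ.zonal, hφ.continuous_zonal⟩) fun g x y => by
      simp only [ContinuousMap.coe_mk, zonal_apply, dist_smul]
  refine ⟨c, fun x w => ?_⟩
  have hw := congrArg (fun f : V => (f : C(M, ℂ)) x) (hc (hφ.zonal w))
  rw [inner_zonalLp, ← integral_complex_ofReal]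
  simpa only [kernelOperator_apply, ContinuousMap.coe_mk, Submodule.coe_smul,
    ContinuousMap.smul_apply, smul_eq_mul, zonal_apply, Complex.ofReal_mul] using hw

theorem inner_zonalLp_eq_norm_sq_mul (hφ : IsZonalFunctionOf F V φ)
    (hV : IsIrreducibleSpace G V) (p x w : M) :
    inner ℝ (hφ.zonalLp μ x) (hφ.zonalLp μ w) =
      ‖hφ.zonalLp μ p‖ ^ 2 * φ (F (dist x w)) := by
  obtain ⟨c, hc⟩ := hφ.exists_inner_zonalLp_eq_mul μ hV
  have hp : c = (‖hφ.zonalLp μ p‖ ^ 2 : ℝ) := by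
    simpa [hφ.normalized] using (hc p p).symm
  exact_mod_cast hp ▸ hc x w

theorem exists_eq_inner [NeZero μ] (hφ : IsZonalFunctionOf F V φ) (hV : IsIrreducibleSpace G V) :
    ∃ v : M → Lp ℝ 2 μ, ∀ x w, φ (F (dist x w)) = inner ℝ (v x) (v w) := by
  obtain ⟨p⟩ : Nonempty M := μ.nonempty_of_neZero
  have hp : ‖hφ.zonalLp μ p‖ ≠ 0 := norm_ne_zero_iff.mpr (hφ.zonalLp_ne_zero μ G p)
  refine ⟨fun x => ‖hφ.zonalLp μ p‖⁻¹ • hφ.zonalLp μ x, fun x w => ?_⟩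
  rw [real_inner_smul_left, real_inner_smul_right, hφ.inner_zonalLp_eq_norm_sq_mul μ hV p x w]
  field_simp

end IsZonalFunctionOf

theorem theorem7p1_general {G M ι : Type*} [Finite ι] [Group G] [MetricSpace M] [MulAction G M]
    [TwoPointHomogeneousSpace G M] [CompactSpace M] [MeasurableSpace M] [BorelSpace M]
    (μ : Measure M) [IsFiniteMeasure μ] [NeZero μ] [SMulInvariantMeasure G M μ]
    {F φ : ℝ → ℝ} {V : Submodule ℂ C(M, ℂ)} (hV : IsIrreducibleSpace G V)
    (hφ : IsZonalFunctionOf F V φ) (X : ι → Finset M) :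
    (Matrix.of fun i j : ι => zonalSum F φ (X i) (X j)).PosSemidef := by
  obtain ⟨v, hv⟩ := hφ.exists_eq_inner μ hV
  have hgram : (Matrix.of fun i j => zonalSum F φ (X i) (X j)) =
      Matrix.gram ℝ fun i => ∑ x ∈ X i, v x := by
    ext i j
    simp only [Matrix.of_apply, Matrix.gram_apply, zonalSum, hv, sum_inner, inner_sum]
    exact Finset.sum_comm
  exact hgram ▸ Matrix.posSemidef_gram ℝ _

theorem theorem7p1 {G M : Type*} [Group G] [MetricSpace M] [MulAction G M]
    [TwoPointHomogeneousSpace G M] [CompactSpace M] [MeasurableSpace M] [BorelSpace M]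
    (μ : Measure M) [IsProbabilityMeasure μ] [SMulInvariantMeasure G M μ]
    (F : ℝ → ℝ) (N : ℕ∞) (Φ : ℕ → ℝ → ℝ) (hΦ : IsZonalSystem G μ F N Φ)
    {d : ℕ} (X : Fin d → Finset M) (k : ℕ) (hk : (k : ℕ∞) < N) :
    (Matrix.of fun i j : Fin d => zonalSum F (Φ k) (X i) (X j)).PosSemidef := by
  obtain ⟨V, hV, hΦ⟩ := hΦ
  exact theorem7p1_general μ (hV.irreducible k hk) (hΦ k hk) X
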